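/- Let $p$ be a prime, let $n\ge 0$ be an even integer and let $m\ge 0$ be an integer with $m\le n/2$. Then there exist an almost balanced bent function $F\colon\mathbb F_p^n\to\mathbb F_p^m$ of type $(+)$ and an almost balanced bent function $F\colon\mathbb F_p^n\to\mathbb F_p^m$ of type $(-)$. Here, for finite additively written groups $G,H$, a function $F\colon G\to H$ is called perfect nonlinear (or bent, when $G$ and $H$ are elementary abelian) if $$|\{x\in G : F(x+a)-F(x)=b\}|=\frac{|G|}{|H|}\qquad\text{for all } a\in G\setminus\{0\},\ b\in H.$$ A perfect nonlinear function $F\colon G\to H$ is called almost balanced of type $(+)$ if there is $\alpha\in H$ with $$|F^{-1}(\alpha)|=\frac{|G|}{|H|}+\sqrt{|G|}-\frac{\sqrt{|G|}}{|H|},\qquad |F^{-1}(\beta)|=\frac{|G|}{|H|}-\frac{\sqrt{|G|}}{|H|}\ \text{ for all }\beta\in H\setminus\{\alpha\},$$ and almost balanced of type $(-)$ if there is $\alpha\in H$ with $$|F^{-1}(\alpha)|=\frac{|G|}{|H|}-\sqrt{|G|}+\frac{\sqrt{|G|}}{|H|},\qquad |F^{-1}(\beta)|=\frac{|G|}{|H|}+\frac{\sqrt{|G|}}{|H|}\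 \text{ for all }\beta\in H\setminus\{\alpha\}.$$ -/

import Mathlib

/-- A map `F` between finite (additively written) groups is perfect nonlinear (between elementary
abelian groups: bent) if for every `a ≠ 0` and every `b` the equation `F (x + a) - F x = b` has
exactly `|G| / |H|` solutions. The quotient is the exact one, taken in `ℝ`. -/
def IsPerfectNonlinear {G H : Type*} [AddGroup G] [AddGroup H] [Finite G] [Finite H]
    (F : G → H) : Prop :=
  ∀ a : G, a ≠ 0 → ∀ b : H,
    (({x : G | F (x + a) - F x = b}.ncard : ℕ) : ℝ) = (Nat.card G : ℝ) / (Nat.card H : ℝ)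

/-- The value distribution of `F` is extremal of type (+): one preimage set has the maximal size
`|G|/|H| + √|G| - √|G|/|H|` and all others have size `|G|/|H| - √|G|/|H|`. -/
def HasExtremalDistributionPlus {G H : Type*} [Finite G] [Finite H] (F : G → H) : Prop :=
  ∃ α : H,
    (((F ⁻¹' {α}).ncard : ℕ) : ℝ) =
        (Nat.card G : ℝ) / (Nat.card H : ℝ) + √(Nat.card G : ℝ)
          - √(Nat.card G : ℝ) / (Nat.card H : ℝ) ∧
      ∀ β : H, β ≠ α →
        (((F ⁻¹' {β}).ncard : ℕ) : ℝ) =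
          (Nat.card G : ℝ) / (Nat.card H : ℝ) - √(Nat.card G : ℝ) / (Nat.card H : ℝ)

/-- The value distribution of `F` is extremal of type (-): one preimage set has the minimal size
`|G|/|H| - √|G| + √|G|/|H|` and all others have size `|G|/|H| + √|G|/|H|`. -/
def HasExtremalDistributionMinus {G H : Type*} [Finite G] [Finite H] (F : G → H) : Prop :=
  ∃ α : H,
    (((F ⁻¹' {α}).ncard : ℕ) : ℝ) =
        (Nat.card G : ℝ) / (Nat.card H : ℝ) - √(Nat.card G : ℝ)
          + √(Nat.card G : ℝ) / (Nat.card H : ℝ) ∧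
      ∀ β : H, β ≠ α →
        (((F ⁻¹' {β}).ncard : ℕ) : ℝ) =
          (Nat.card G : ℝ) / (Nat.card H : ℝ) + √(Nat.card G : ℝ) / (Nat.card H : ℝ)

/-- Almost balanced perfect nonlinear functions of type (+). -/
def IsAlmostBalancedPlus {G H : Type*} [AddGroup G] [AddGroup H] [Finite G] [Finite H]
    (F : G → H) : Prop :=
  IsPerfectNonlinear F ∧ HasExtremalDistributionPlus F

/-- Almost balanced perfect nonlinear functions of type (-). -/
def IsAlmostBalancedMinus {G H : Type*} [AddGroup G] [AddGroup H] [Finite G] [Finite H]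
    (F : G → H) : Prop :=
  IsPerfectNonlinear F ∧ HasExtremalDistributionMinus F

/-! Let `q = p ^ (n / 2)` and `K` the field of order `q`. Two quadratic maps onto `K` serve as
models: multiplication on `K × K` for type (+), the norm of the quadratic extension `M` of `K` for
type (-). In each nonzero direction their derivative is a surjective additive map plus a constant.
The product has `2q - 1` zeros and `q - 1` points over each other value; the norm has `1` and `q +
1`. Composing with a surjective additive `L : K → H` keeps the derivatives surjective and affine.
Each fiber of `L` has `q / |H|` points, so fibers have size `(q ∓ 1) q / |H|`, with an extra `±q`
over `0`. As `√|G| = q`, these are the extremal sizes. -/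

theorem AddMonoidHom.ncard_fiber_of_surjective {G H : Type*} [AddGroup G] [AddGroup H]
    [Finite G] [Finite H] (f : G →+ H) (hf : Function.Surjective f) (b : H) :
    (({x : G | f x = b}.ncard : ℕ) : ℝ) = (Nat.card G : ℝ) / (Nat.card H : ℝ) := by
  classical
  have := Fintype.ofFinite G
  have := Fintype.ofFinite H
  have hconst (c : H) :
      (Finset.univ.filter fun x => f x = c).card = (Finset.univ.filter fun x => f x = b).card :=
    AddMonoidHom.card_fiber_eq_of_mem_range f (hf c) (hf b)
  have hsum := Finset.card_eq_sum_card_fiberwise (f := f) (s := Finset.univ)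
    (t := Finset.univ) (fun _ _ => Finset.mem_coe.2 (Finset.mem_univ _))
  simp only [hconst, Finset.sum_const, Finset.card_univ, smul_eq_mul] at hsum
  have hH : (Fintype.card H : ℝ) ≠ 0 := by
    exact_mod_cast Fintype.card_ne_zero
  rw [Set.ncard_eq_toFinset_card', Set.toFinset_ofPred, Nat.card_eq_fintype_card,
    Nat.card_eq_fintype_card, eq_div_iff hH, mul_comm]
  exact_mod_cast hsum.symm

/-- The fiber of a composition is the disjoint union of fibers of the inner map. -/
theorem ncard_preimage_comp {G K H : Type*} [Finite G] [Fintype K] [DecidableEq H]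
    (Q : G → K) (L : K → H) (b : H) :
    ((L ∘ Q) ⁻¹' {b}).ncard = ∑ c : K with L c = b, (Q ⁻¹' {c}).ncard := by
  classical
  have := Fintype.ofFinite G
  simp only [Set.ncard_eq_toFinset_card']
  rw [Finset.card_eq_sum_card_fiberwise (f := Q) (t := Finset.univ.filter fun c => L c = b)]
  · refine Finset.sum_congr rfl fun c hc => ?_
    congr 1
    ext x
    simp only [Finset.mem_filter, Finset.mem_univ, true_and] at hc
    simp only [Finset.mem_filter, Set.mem_toFinset, Set.mem_preimage, Set.mem_singleton_iff,
      Function.comp_apply]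
    exact ⟨fun h => h.2, fun h => ⟨h ▸ hc, h⟩⟩
  · intro x hx
    simpa using hx

/-- Derivatives of `F` in nonzero directions that are surjective affine maps make `F` perfect
nonlinear. -/
theorem isPerfectNonlinear_of_affine_derivative {G H : Type*} [AddGroup G] [AddGroup H]
    [Finite G] [Finite H] (F : G → H)
    (hF : ∀ a : G, a ≠ 0 → ∃ (f : G →+ H) (c : H), Function.Surjective f ∧
      ∀ x, F (x + a) - F x = f x + c) :
    IsPerfectNonlinear F := by
  intro a ha b
  obtain ⟨f, c, hf, h⟩ := hF a ha
  simp only [h, ← eq_sub_iff_add_eq]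
  exact f.ncard_fiber_of_surjective hf _

theorem isPerfectNonlinear_comp {G' G K H : Type*} [AddGroup G'] [AddGroup G] [AddGroup K]
    [AddGroup H] [Finite G'] [Finite H] (Q : G → K) (e : G' ≃+ G) (L : K →+ H)
    (hL : Function.Surjective L)
    (hQ : ∀ a : G, a ≠ 0 → ∃ (f : G →+ K) (c : K), Function.Surjective f ∧
      ∀ x, Q (x + a) - Q x = f x + c) :
    IsPerfectNonlinear (L ∘ Q ∘ e) := by
  refine isPerfectNonlinear_of_affine_derivative _ fun a ha => ?_
  obtain ⟨f, c, hf, h⟩ := hQ (e a) (by simpa using ha)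
  refine ⟨(L.comp f).comp e.toAddMonoidHom, L c, (hL.comp hf).comp e.surjective, fun x => ?_⟩
  simp [← map_sub, h]

/-- The value distribution of `L ∘ Q ∘ e` when the fiber of `Q` over `0` has size `s` and all its
other fibers have size `r`. -/
theorem ncard_preimage_comp_of_two_sizes {G' G K H : Type*} [AddGroup K] [AddGroup H]
    [Finite G'] [Finite G] [Finite K] [Finite H] (Q : G → K) (e : G' ≃ G) (L : K →+ H)
    (hL : Function.Surjective L) (r s : ℝ)
    (h0 : ((Q ⁻¹' {0}).ncard : ℝ) = s)
    (hr : ∀ c, c ≠ 0 → ((Q ⁻¹' {c}).ncard : ℝ) = r) :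
    (((L ∘ Q ∘ e) ⁻¹' {0}).ncard : ℝ) = s - r + r * (Nat.card K / Nat.card H) ∧
      ∀ b, b ≠ 0 → (((L ∘ Q ∘ e) ⁻¹' {b}).ncard : ℝ) = r * (Nat.card K / Nat.card H) := by
  classical
  have := Fintype.ofFinite K
  have he (b : H) : ((L ∘ Q ∘ e) ⁻¹' {b}).ncard = ((L ∘ Q) ⁻¹' {b}).ncard := by
    rw [← Function.comp_assoc, Set.preimage_comp,
      Set.ncard_preimage_of_injective_subset_range e.injective (by simp)]
  have hcard (b : H) : ((Finset.univ.filter fun c => L c = b).card : ℝ)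
      = Nat.card K / Nat.card H := by
    rw [← L.ncard_fiber_of_surjective hL b, Set.ncard_eq_toFinset_card', Set.toFinset_ofPred]
  -- A constant plus a spike at `0`: summed over a fiber of `L`, the spike contributes only when `b
  -- = 0`.
  have hval (c : K) : ((Q ⁻¹' {c}).ncard : ℝ) = r + if c = 0 then s - r else 0 := by
    split_ifs with h
    · rw [h, h0]; ring
    · rw [hr c h, add_zero]
  have key (b : H) : (((L ∘ Q ∘ e) ⁻¹' {b}).ncard : ℝ)
      = r * (Nat.card K / Nat.card H) + if b = 0 then s - r else 0 := by
    rw [he, ncard_preimage_comp, Nat.cast_sum, ← hcard b]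
    simp only [hval, Finset.sum_add_distrib, Finset.sum_const, nsmul_eq_mul,
      Finset.sum_ite_eq', Finset.mem_filter, Finset.mem_univ, true_and, map_zero]
    simp only [eq_comm (a := (0 : H)), mul_comm]
  refine ⟨?_, fun b hb => ?_⟩
  · rw [key, if_pos rfl, add_comm]
  · rw [key, if_neg hb, add_zero]

section Multiplication

variable (K : Type*) [Field K]

theorem exists_affine_derivative_mul (a : K × K) (ha : a ≠ 0) :
    ∃ (f : K × K →+ K) (c : K), Function.Surjective f ∧
      ∀ x : K × K, (x + a).1 * (x + a).2 - x.1 * x.2 = f x + c := by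
  refine ⟨(AddMonoidHom.mulRight a.2).comp (AddMonoidHom.fst K K) +
    (AddMonoidHom.mulLeft a.1).comp (AddMonoidHom.snd K K), a.1 * a.2, fun y => ?_, fun x => ?_⟩
  · by_cases h : a.1 = 0
    · have h2 : a.2 ≠ 0 := fun h2 => ha (Prod.ext h h2)
      exact ⟨(y / a.2, 0), by simp [h2]⟩
    · exact ⟨(0, y / a.1), by simp [mul_div_cancel₀, h]⟩
  · simp only [Prod.fst_add, Prod.snd_add, AddMonoidHom.add_apply, AddMonoidHom.comp_apply,
      AddMonoidHom.mulRight_apply, AddMonoidHom.coe_mulLeft, AddMonoidHom.coe_fst,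
      AddMonoidHom.coe_snd]
    ring

theorem ncard_mul_preimage [Finite K] (c : K) (hc : c ≠ 0) :
    (((fun x : K × K => x.1 * x.2) ⁻¹' {c}).ncard : ℝ) = Nat.card K - 1 := by
  have h : (fun x : K × K => x.1 * x.2) ⁻¹' {c} = (fun t : K => (t, c / t)) '' {0}ᶜ := by
    ext ⟨x, y⟩
    simp only [Set.mem_preimage, Set.mem_singleton_iff, Set.mem_image, Set.mem_compl_iff,
      Prod.mk.injEq]
    constructor
    · rintro rfl
      have hx := left_ne_zero_of_mul hc
      exact ⟨x, hx, rfl, by field_simp⟩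
    · rintro ⟨t, ht, rfl, rfl⟩
      field_simp
  rw [h, Set.ncard_image_of_injective _ fun s t hst => (Prod.ext_iff.1 hst).1, Set.ncard_compl,
    Set.ncard_singleton, Nat.cast_sub Nat.card_pos, Nat.cast_one]

theorem ncard_mul_preimage_zero [Finite K] :
    (((fun x : K × K => x.1 * x.2) ⁻¹' {0}).ncard : ℝ) = 2 * Nat.card K - 1 := by
  have h : (fun x : K × K => x.1 * x.2) ⁻¹' {0}
      = (fun t : K => (t, (0 : K))) '' Set.univ ∪ (fun t : K => ((0 : K), t)) '' {0}ᶜ := by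
    ext ⟨x, y⟩
    simp only [Set.mem_preimage, Set.mem_singleton_iff, mul_eq_zero, Set.mem_union, Set.mem_image,
      Set.mem_univ, true_and, Set.mem_compl_iff, Prod.mk.injEq]
    constructor
    · intro hxy
      by_cases hy : y = 0
      · exact Or.inl ⟨x, rfl, hy.symm⟩
      · exact Or.inr ⟨y, hy, (hxy.resolve_right hy).symm, rfl⟩
    · rintro (⟨_, _, rfl⟩ | ⟨_, _, rfl, _⟩) <;> simp
  rw [h, Set.ncard_union_eq, Set.ncard_image_of_injective _ fun s t hst => (Prod.ext_iff.1 hst).1,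
    Set.ncard_image_of_injective _ fun s t hst => (Prod.ext_iff.1 hst).2, Set.ncard_compl,
    Set.ncard_singleton, Set.ncard_univ, Nat.cast_add, Nat.cast_sub Nat.card_pos, Nat.cast_one]
  · ring
  · rw [Set.disjoint_left]
    rintro _ ⟨s, -, rfl⟩ ⟨t, ht, h⟩
    exact ht (Prod.ext_iff.1 h).2

end Multiplication

section QuadraticNorm

variable (K M : Type*) [Field K] [Field M] [Finite M] [Algebra K M]

theorem ncard_norm_preimage_zero : ((Algebra.norm K (S := M) ⁻¹' {0}).ncard : ℝ) = 1 := by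
  have h : Algebra.norm K (S := M) ⁻¹' {0} = {0} := by
    ext x
    simp [Algebra.norm_eq_zero_iff]
  simp [h]

variable [Finite K]

/-- Since `N x = x ^ (q + 1)`, the polarization is `N (x + a) - N x = Tr (x * a ^ q) + N a`, and the
trace is surjective. -/
theorem exists_affine_derivative_norm (hKM : Module.finrank K M = 2) (a : M) (ha : a ≠ 0) :
    ∃ (f : M →+ K) (c : K), Function.Surjective f ∧
      ∀ x : M, Algebra.norm K (x + a) - Algebra.norm K x = f x + c := by
  have hcard : Nat.card M = Nat.card K ^ 2 := by
    rw [Module.natCard_eq_pow_finrank (K := K), hKM]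
  have hfrob (x y : M) : (x + y) ^ Nat.card K = x ^ Nat.card K + y ^ Nat.card K := by
    have := Fintype.ofFinite K
    simpa [Nat.card_eq_fintype_card] using map_add (FiniteField.frobeniusAlgHom K M) x y
  -- Makes `x ^ q * a` the conjugate of `x * a ^ q`.
  have hsq : (a ^ Nat.card K) ^ Nat.card K = a := by
    have := Fintype.ofFinite M
    rw [← pow_mul, ← sq, ← hcard, Nat.card_eq_fintype_card, FiniteField.pow_card]
  refine ⟨(Algebra.trace K M).toAddMonoidHom.comp (AddMonoidHom.mulRight (a ^ Nat.card K)),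
    Algebra.norm K a, fun y => ?_, fun x => ?_⟩
  · obtain ⟨z, hz⟩ := Algebra.trace_surjective K M y
    exact ⟨z / a ^ Nat.card K, by simp [ha, hz]⟩
  · apply (algebraMap K M).injective
    simp only [AddMonoidHom.comp_apply, AddMonoidHom.mulRight_apply, map_sub, map_add,
      LinearMap.toAddMonoidHom_coe, FiniteField.algebraMap_norm_eq_prod_pow,
      FiniteField.algebraMap_trace_eq_sum_pow, hKM, Finset.sum_range_succ,
      Finset.prod_range_succ, Finset.sum_range_zero, Finset.prod_range_zero, pow_zero, pow_one,
      hfrob, mul_pow, hsq]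
    ring

/-- Multiplying by an element of norm `d / c` matches the fibers over `c` and `d`. If `N` is their
common size, then `q ^ 2 = 1 + (q - 1) * N`. -/
theorem ncard_norm_preimage (hKM : Module.finrank K M = 2) (c : K) (hc : c ≠ 0) :
    ((Algebra.norm K (S := M) ⁻¹' {c}).ncard : ℝ) = Nat.card K + 1 := by
  classical
  have := Fintype.ofFinite K
  have := Fintype.ofFinite M
  have hfiber (d : K) (hd : d ≠ 0) :
      (Algebra.norm K (S := M) ⁻¹' {d}).ncard = (Algebra.norm K (S := M) ⁻¹' {c}).ncard := by
    obtain ⟨z, hz⟩ := FiniteField.norm_surjective K M (d / c)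
    have hz0 : z ≠ 0 := by
      rintro rfl
      rw [Algebra.norm_zero] at hz
      exact div_ne_zero hd hc hz.symm
    rw [← Set.ncard_preimage_of_injective_subset_range (mul_right_injective₀ hz0)
      (fun x _ => ⟨x / z, by simp [mul_div_cancel₀, hz0]⟩)]
    congr 1
    ext x
    simp only [Set.mem_preimage, Set.mem_singleton_iff, map_mul, hz]
    rw [div_mul_eq_mul_div, div_eq_iff hc, mul_right_inj' hd]
  have hcard : Nat.card M = Nat.card K ^ 2 := by
    rw [Module.natCard_eq_pow_finrank (K := K), hKM]
  -- Composing with the map to a point makes the fiber all of `M`.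
  have hsum := ncard_preimage_comp (Algebra.norm K (S := M)) (fun _ : K => ()) ()
  have huniv : ((fun _ : K => ()) ∘ Algebra.norm K (S := M)) ⁻¹' {()} = Set.univ := by
    ext; simp
  rw [huniv, Set.ncard_univ, hcard, Finset.filter_true_of_mem (by simp),
    ← Finset.add_sum_erase _ _ (Finset.mem_univ (0 : K)),
    Finset.sum_congr rfl fun d hd => hfiber d (Finset.ne_of_mem_erase hd), Finset.sum_const,
    Finset.card_erase_of_mem (Finset.mem_univ _), Finset.card_univ, smul_eq_mul,
    ← Nat.card_eq_fintype_card] at hsum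
  have hsum' := congrArg (Nat.cast : ℕ → ℝ) hsum
  have h1 : (1 : ℝ) < Nat.card K := by exact_mod_cast Finite.one_lt_card
  push_cast [ncard_norm_preimage_zero, Nat.cast_sub (Nat.card_pos (α := K))] at hsum'
  have h2 : (Nat.card K : ℝ) - 1 ≠ 0 := by linarith
  apply mul_left_cancel₀ h2
  linarith

end QuadraticNorm

theorem isPerfectNonlinear_of_subsingleton {G H : Type*} [AddGroup G] [AddGroup H] [Finite G]
    [Finite H] [Subsingleton H] (F : G → H) : IsPerfectNonlinear F := by
  intro a _ b
  have h : {x : G | F (x + a) - F x = b} = Set.univ :=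
    Set.eq_univ_of_forall fun _ => Subsingleton.elim _ _
  simp [h, Set.ncard_univ]

theorem hasExtremalDistribution_of_subsingleton {G H : Type*} [Finite G] [Finite H]
    [Nonempty H] [Subsingleton H] (F : G → H) :
    HasExtremalDistributionPlus F ∧ HasExtremalDistributionMinus F := by
  obtain ⟨α⟩ := ‹Nonempty H›
  have h : F ⁻¹' {α} = Set.univ := Set.eq_univ_of_forall fun _ => Subsingleton.elim _ _
  exact ⟨⟨α, by simp [h, Set.ncard_univ], fun β hβ => (hβ (Subsingleton.elim _ _)).elim⟩,
    ⟨α, by simp [h, Set.ncard_univ], fun β hβ => (hβ (Subsingleton.elim _ _)).elim⟩⟩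

theorem isAlmostBalancedPlus_comp_mul {G K H : Type*} [AddGroup G] [Finite G] [Field K] [Finite K]
    [AddGroup H] [Finite H] (e : G ≃+ K × K) (L : K →+ H) (hL : Function.Surjective L) :
    IsAlmostBalancedPlus (L ∘ (fun x : K × K => x.1 * x.2) ∘ e) := by
  refine ⟨isPerfectNonlinear_comp _ e L hL (exists_affine_derivative_mul K), 0, ?_⟩
  obtain ⟨h0, h1⟩ := ncard_preimage_comp_of_two_sizes (fun x : K × K => x.1 * x.2) e.toEquiv L hL
    _ _ (ncard_mul_preimage_zero K) (ncard_mul_preimage K)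
  have hG : (Nat.card G : ℝ) = (Nat.card K : ℝ) ^ 2 := by
    rw [Nat.card_congr e.toEquiv, Nat.card_prod]; push_cast; ring
  rw [hG, Real.sqrt_sq (Nat.cast_nonneg _)]
  exact ⟨h0.trans (by ring), fun β hβ => (h1 β hβ).trans (by ring)⟩

theorem isAlmostBalancedMinus_comp_norm {G K M H : Type*} [AddGroup G] [Finite G] [Field K]
    [Finite K] [Field M] [Finite M] [Algebra K M] (hKM : Module.finrank K M = 2)
    [AddGroup H] [Finite H] (e : G ≃+ M) (L : K →+ H) (hL : Function.Surjective L) :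
    IsAlmostBalancedMinus (L ∘ Algebra.norm K (S := M) ∘ e) := by
  refine ⟨isPerfectNonlinear_comp _ e L hL (exists_affine_derivative_norm K M hKM), 0, ?_⟩
  obtain ⟨h0, h1⟩ := ncard_preimage_comp_of_two_sizes (Algebra.norm K (S := M)) e.toEquiv L hL
    _ _ (ncard_norm_preimage_zero K M) (ncard_norm_preimage K M hKM)
  have hG : (Nat.card G : ℝ) = (Nat.card K : ℝ) ^ 2 := by
    rw [Nat.card_congr e.toEquiv, Module.natCard_eq_pow_finrank (K := K), hKM, Nat.cast_pow]
  rw [hG, Real.sqrt_sq (Nat.cast_nonneg _)]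
  exact ⟨h0.trans (by ring), fun β hβ => (h1 β hβ).trans (by ring)⟩

theorem mainTheorem2 (p : ℕ) [Fact p.Prime] (n m : ℕ) (hn : Even n) (hm : m ≤ n / 2) :
    (∃ F : (Fin n → ZMod p) → (Fin m → ZMod p), IsAlmostBalancedPlus F) ∧
      (∃ F : (Fin n → ZMod p) → (Fin m → ZMod p), IsAlmostBalancedMinus F) := by
  -- For `m = 0` the exponent `k = n / 2` may vanish, and `K` would not have dimension `k`; `m > 0`
  -- forces `k > 0`.
  obtain rfl | hm0 := Nat.eq_zero_or_pos m
  · exact ⟨⟨0, isPerfectNonlinear_of_subsingleton _, (hasExtremalDistribution_of_subsingleton _).1⟩,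
      ⟨0, isPerfectNonlinear_of_subsingleton _, (hasExtremalDistribution_of_subsingleton _).2⟩⟩
  obtain ⟨k, rfl⟩ := hn
  have hmk : m ≤ k := by omega
  have hk : k ≠ 0 := by omega
  let K := GaloisField p k
  let M := FiniteField.Extension K p 2
  have hK : Module.finrank (ZMod p) K = k := GaloisField.finrank p hk
  have hM : Module.finrank (ZMod p) M = k + k := by
    rw [FiniteField.finrank_zmod_extension, hK, mul_two]
  let eK : K ≃ₗ[ZMod p] (Fin k → ZMod p) := LinearEquiv.ofFinrankEq _ _ (by simp [hK])
  let eM : (Fin (k + k) → ZMod p) ≃ₗ[ZMod p] M := LinearEquiv.ofFinrankEq _ _ (by simp [hM])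
  let eP : (Fin (k + k) → ZMod p) ≃ₗ[ZMod p] K × K := LinearEquiv.ofFinrankEq _ _ (by simp [hK])
  -- Projection to the first `m` of the `k` coordinates of `K`.
  let L : K →ₗ[ZMod p] (Fin m → ZMod p) :=
    (LinearMap.funLeft (ZMod p) (ZMod p) (Fin.castLE hmk)).comp eK.toLinearMap
  have hL : Function.Surjective L :=
    (LinearMap.funLeft_surjective_of_injective (ZMod p) (ZMod p) _ (Fin.castLE_injective hmk)).comp eK.surjective
  exact ⟨⟨_, isAlmostBalancedPlus_comp_mul eP.toAddEquiv L.toAddMonoidHom hL⟩,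
    ⟨_, isAlmostBalancedMinus_comp_norm (FiniteField.finrank_extension K p 2) eM.toAddEquiv
      L.toAddMonoidHom hL⟩⟩
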